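/- Let $G$ be a complex vector space of finite dimension $g\ge 1$, and let $S=\operatorname{Sym}(G^*\oplus\bigwedge^2G^*)$ be the homogeneous coordinate ring of $\mathbb P(G^*\oplus\bigwedge^2G^*)$, where $\mathbb P(W)$ denotes the projective space of one-dimensional quotients of $W$. The second generic syzygy ideal $I\subset S$ of $G$ is the ideal generated by the image of the natural inclusion $\bigwedge^3G^*\subset G^*\otimes\bigwedge^2G^*\subset S$, that is, by the quadrics $a\cdot(b\wedge c)-b\cdot(a\wedge c)+c\cdot(a\wedge b)$ with $a,b,c\in G^*$. The second generic syzygy scheme $\mathrm{Gensyz}_2(G)$ is the vanishing set of $I$. Identify $\bigwedge^2(\mathbb C\oplus G^*)$ with $G^*\oplus\bigwedge^2G^*$ by $(s,u)\wedge(t,v)\mapsto(sv-tu,\,u\wedge v)$. Let $\mathbb G(\mathbb C\oplus G^*,2)\subset\mathbb P(G^*\oplus\bigwedge^2G^*)$ be the Grassmannian of two-dimensional quotients of $\mathbb C\oplus G^*$ in its Plücker embedding. Let $I_{\mathbb G}\subset S$ be the Plücker ideal, generated by $\bigwedge^4(\mathbb C\oplus G^*)$, that is, by the $4\times4$ Pfaffians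 $(a\wedge b)(c\wedge d)-(a\wedge c)(b\wedge d)+(a\wedge d)(b\wedge c)$ with $a,b,c,d\in\mathbb C\oplus G^*$. Let $\mathbb P(\bigwedge^2G^*)\subset\mathbb P(G^*\oplus\bigwedge^2G^*)$ be the linear subspace cut out by the ideal $(G^*)\subset S$ generated by the linear forms in $G^*$. Then: 1. $\mathrm{Gensyz}_2(G)=\mathbb G(\mathbb C\oplus G^*,2)\cup\mathbb P(\bigwedge^2G^*)$ as sets of closed points; 2. $I=I_{\mathbb G}\cap(G^*)$, and $I_{\mathbb G}$ is the homogeneous vanishing ideal of $\mathbb G(\mathbb C\oplus G^*,2)$ (so the equality in 1 also holds scheme-theoretically); 3. $I$ is reduced (a radical ideal) and saturated with respect to the irrelevant ideal of $S$. -/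

import Mathlib

open scoped LinearAlgebra.Projectivization

noncomputable section

namespace Gensyz

/-! ### Projective spaces, zero loci and ideals

For a vector space `W` the homogeneous coordinate ring of the projective space `P(W)` in
Grothendieck's notation is `SymmetricAlgebra ℂ W`, so that `W` is the space of linear forms.
A closed point of `P(W)` is a one-dimensional quotient of `W`, i.e. a nonzero linear functional on
`W` up to a scalar, i.e. a point of `ℙ ℂ (Module.Dual ℂ W)`. -/

section Projective

variable {W : Type*} [AddCommGroup W] [Module ℂ W]

/-- The zero locus in `P(W)` of an ideal of the coordinate ring: the points `p` such that every
element of the ideal vanishes on the whole line of functionals represented by `p`. (For a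
homogeneous ideal this is the vanishing at one representative.) -/
def zeroLocus (I : Ideal (SymmetricAlgebra ℂ W)) : Set (ℙ ℂ (Module.Dual ℂ W)) :=
  {p | ∀ f ∈ I, ∀ φ ∈ p.submodule, SymmetricAlgebra.lift φ f = 0}

/-- The homogeneous vanishing ideal of a set `Z` of points of `P(W)`: the elements of the coordinate
ring that vanish on the affine cone over `Z`. -/
def vanishingIdeal (Z : Set (ℙ ℂ (Module.Dual ℂ W))) : Ideal (SymmetricAlgebra ℂ W) where
  carrier := {f | ∀ p ∈ Z, ∀ φ ∈ p.submodule, SymmetricAlgebra.lift φ f = 0}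
  add_mem' hf hg p hp φ hφ := by rw [map_add, hf p hp φ hφ, hg p hp φ hφ, add_zero]
  zero_mem' p _ φ _ := map_zero _
  smul_mem' c f hf p hp φ hφ := by rw [smul_eq_mul, map_mul, hf p hp φ hφ, mul_zero]

variable (W) in
/-- The irrelevant ideal of the coordinate ring of `P(W)`: it is generated by all linear forms. -/
def irrelevantIdeal : Ideal (SymmetricAlgebra ℂ W) :=
  Ideal.span (Set.range (SymmetricAlgebra.ι ℂ W))

/-- An ideal is saturated if it contains every element that some power of the irrelevant ideal
multiplies into it. -/
def IsSaturated (I : Ideal (SymmetricAlgebra ℂ W)) : Prop :=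
  ∀ (f : SymmetricAlgebra ℂ W) (n : ℕ), (∀ m ∈ irrelevantIdeal W ^ n, m * f ∈ I) → f ∈ I

end Projective

/-! ### Generic syzygy ideals -/

section GenericSyzygies

variable (k : ℕ) (G : Type*) [AddCommGroup G] [Module ℂ G]

/-- The space of linear forms `G* ⊕ ⋀ᵏ G*`. -/
abbrev Forms : Type _ := Module.Dual ℂ G × ⋀[ℂ]^k (Module.Dual ℂ G)

/-- The inclusion of `G*` into the coordinate ring of `P(G* ⊕ ⋀ᵏ G*)`. -/
def formsLeft : Module.Dual ℂ G →ₗ[ℂ] SymmetricAlgebra ℂ (Forms k G) :=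
  SymmetricAlgebra.ι ℂ (Forms k G) ∘ₗ LinearMap.inl ℂ _ _

/-- The inclusion of `⋀ᵏ G*` into the coordinate ring of `P(G* ⊕ ⋀ᵏ G*)`. -/
def formsRight : ⋀[ℂ]^k (Module.Dual ℂ G) →ₗ[ℂ] SymmetricAlgebra ℂ (Forms k G) :=
  SymmetricAlgebra.ι ℂ (Forms k G) ∘ₗ LinearMap.inr ℂ _ _

/-- The product `a · (v₁ ∧ ⋯ ∧ v_k)` of a linear form in `G*` and a linear form in `⋀ᵏ G*`, linear
in `a` and alternating in the `v`'s. -/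
def mixedProduct : Module.Dual ℂ G →ₗ[ℂ]
    (Module.Dual ℂ G) [⋀^Fin k]→ₗ[ℂ] SymmetricAlgebra ℂ (Forms k G) where
  toFun a := (LinearMap.mulLeft ℂ (formsLeft k G a) ∘ₗ formsRight k G).compAlternatingMap
    (exteriorPower.ιMulti ℂ k)
  map_add' a b := by ext v; simp [add_mul]
  map_smul' c a := by ext v; simp

/-- The natural inclusion `⋀ᵏ⁺¹ G* ⊂ G* ⊗ ⋀ᵏ G* ⊂ S²(G* ⊕ ⋀ᵏ G*) ⊂ S`, which sends
`v₀ ∧ ⋯ ∧ v_k` to `∑ᵢ (-1)ⁱ vᵢ · (v₀ ∧ ⋯ omit vᵢ ⋯ ∧ v_k)`. -/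
def syzygyQuadric : ⋀[ℂ]^(k + 1) (Module.Dual ℂ G) →ₗ[ℂ] SymmetricAlgebra ℂ (Forms k G) :=
  exteriorPower.alternatingMapLinearEquiv (AlternatingMap.alternatizeUncurryFin (mixedProduct k G))

theorem syzygyQuadric_ιMulti (v : Fin (k + 1) → Module.Dual ℂ G) :
    syzygyQuadric k G (exteriorPower.ιMulti ℂ (k + 1) v) =
      ∑ i : Fin (k + 1), (-1) ^ (i : ℕ) •
        (formsLeft k G (v i) * formsRight k G (exteriorPower.ιMulti ℂ k (i.removeNth v))) := by
  simp only [syzygyQuadric, exteriorPower.alternatingMapLinearEquiv_apply_ιMulti,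
    AlternatingMap.alternatizeUncurryFin_apply]
  rfl

/-- The `k`-th generic syzygy ideal of `G`, generated by `⋀ᵏ⁺¹ G*`. -/
def gensyzIdeal : Ideal (SymmetricAlgebra ℂ (Forms k G)) :=
  Ideal.span (Set.range (syzygyQuadric k G))

/-- The `k`-th generic syzygy scheme of `G`: the vanishing set of the generic syzygy ideal. -/
def gensyz : Set (ℙ ℂ (Module.Dual ℂ (Forms k G))) :=
  zeroLocus (gensyzIdeal k G)

/-- The ideal `(G*)` generated by the linear forms in `G*`. -/
def linearIdeal : Ideal (SymmetricAlgebra ℂ (Forms k G)) :=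
  Ideal.span (Set.range (formsLeft k G))

/-- The linear subspace `P(⋀ᵏ G*) ⊂ P(G* ⊕ ⋀ᵏ G*)` given by the projection
`G* ⊕ ⋀ᵏ G* → ⋀ᵏ G*`: a one-dimensional quotient of `⋀ᵏ G*` is one of `G* ⊕ ⋀ᵏ G*`. -/
def linearSubspace : Set (ℙ ℂ (Module.Dual ℂ (Forms k G))) :=
  Set.range (Projectivization.map
    (LinearMap.snd ℂ (Module.Dual ℂ G) (⋀[ℂ]^k (Module.Dual ℂ G))).dualMap
    (LinearMap.dualMap_injective_of_surjective LinearMap.snd_surjective))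

end GenericSyzygies

/-! ### The Plücker embedding and the Plücker ideal -/

section Pluecker

variable {E : Type*} [AddCommGroup E] [Module ℂ E]

/-- A two-dimensional quotient `E → E ⧸ N` induces a one-dimensional quotient
`⋀² E → ⋀² (E ⧸ N)`, so that the functionals on `⋀² E` that factor through it form a line. -/
theorem finrank_range_dualMap_mkQ (N : Module.Grassmannian ℂ E 2) :
    Module.finrank ℂ
      (LinearMap.range (exteriorPower.map 2 N.toSubmodule.mkQ).dualMap) = 1 := by
  have h2 : Module.finrank ℂ (E ⧸ N.toSubmodule) = 2 := by
    have h := N.rankAtStalk_eq ⊥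
    rw [Module.rankAtStalk_eq_finrank_of_free] at h
    simpa using h
  rw [LinearMap.finrank_range_of_inj (LinearMap.dualMap_injective_of_surjective
    (exteriorPower.map_surjective (Submodule.mkQ_surjective _))), Subspace.dual_finrank_eq,
    exteriorPower.finrank_eq, h2]
  rfl

/-- The Plücker embedding of the Grassmannian of two-dimensional quotients of `E` into `P(⋀² E)`:
it sends a quotient `E → E ⧸ N` to the one-dimensional quotient `⋀² E → ⋀² (E ⧸ N)`. -/
def pluecker (N : Module.Grassmannian ℂ E 2) : ℙ ℂ (Module.Dual ℂ (⋀[ℂ]^2 E)) :=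
  Projectivization.mk'' (LinearMap.range (exteriorPower.map 2 N.toSubmodule.mkQ).dualMap)
    (finrank_range_dualMap_mkQ N)

/-- The linear form `a ∧ b` in the coordinate ring of `P(⋀² E)`. -/
def wedge (a b : E) : SymmetricAlgebra ℂ (⋀[ℂ]^2 E) :=
  SymmetricAlgebra.ι ℂ (⋀[ℂ]^2 E) (exteriorPower.ιMulti ℂ 2 ![a, b])

variable (E) in
/-- The Plücker ideal, generated by the image of `⋀⁴ E` in `S²(⋀² E)`, i.e. by the `4 × 4`
Pfaffians `(a ∧ b)(c ∧ d) - (a ∧ c)(b ∧ d) + (a ∧ d)(b ∧ c)`. -/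
def plueckerIdeal : Ideal (SymmetricAlgebra ℂ (⋀[ℂ]^2 E)) :=
  Ideal.span {q | ∃ a b c d : E,
    q = wedge a b * wedge c d - wedge a c * wedge b d + wedge a d * wedge b c}

end Pluecker

/-! ### The identification `⋀² (ℂ ⊕ V) = V ⊕ ⋀² V` -/

section Splitting

variable (V : Type*) [AddCommGroup V] [Module ℂ V]

/-- The map `⋀² (ℂ ⊕ V) → V`, `(s, u) ∧ (t, v) ↦ s v - t u`. -/
def splitFst : ⋀[ℂ]^2 (ℂ × V) →ₗ[ℂ] V :=
  exteriorPower.alternatingMapLinearEquiv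
    { toFun := fun p => (p 0).1 • (p 1).2 - (p 1).1 • (p 0).2
      map_update_add' := by
        intro _ p i x y
        fin_cases i <;> simp [add_smul] <;> abel
      map_update_smul' := by
        intro _ p i c x
        fin_cases i <;> simp [smul_sub, smul_smul, mul_comm]
      map_eq_zero_of_eq' := by
        intro p i j h hij
        have h01 : p 0 = p 1 := by
          fin_cases i <;> fin_cases j <;> simp_all
        rw [h01, sub_self] }

theorem splitFst_ιMulti (p : Fin 2 → ℂ × V) :
    splitFst V (exteriorPower.ιMulti ℂ 2 p) = (p 0).1 • (p 1).2 - (p 1).1 • (p 0).2 :=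
  exteriorPower.alternatingMapLinearEquiv_apply_ιMulti _ _

theorem wedge_two_add_left (M : Type*) [AddCommGroup M] [Module ℂ M] (a b c : M) :
    exteriorPower.ιMulti ℂ 2 ![a + b, c] =
      exteriorPower.ιMulti ℂ 2 ![a, c] + exteriorPower.ιMulti ℂ 2 ![b, c] :=
  (exteriorPower.ιMulti ℂ 2 (M := M)).toMultilinearMap.cons_add ![c] a b

theorem wedge_two_smul_left (M : Type*) [AddCommGroup M] [Module ℂ M] (s : ℂ) (a c : M) :
    exteriorPower.ιMulti ℂ 2 ![s • a, c] = s • exteriorPower.ιMulti ℂ 2 ![a, c] :=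
  (exteriorPower.ιMulti ℂ 2 (M := M)).toMultilinearMap.cons_smul ![c] s a

theorem wedge_two_self (M : Type*) [AddCommGroup M] [Module ℂ M] (a : M) :
    exteriorPower.ιMulti ℂ 2 ![a, a] = 0 :=
  (exteriorPower.ιMulti ℂ 2 (M := M)).map_eq_zero_of_eq ![a, a] (i := 0) (j := 1) rfl
    zero_ne_one

theorem wedge_two_swap (M : Type*) [AddCommGroup M] [Module ℂ M] (a b : M) :
    exteriorPower.ιMulti ℂ 2 ![a, b] = -exteriorPower.ιMulti ℂ 2 ![b, a] := by
  have h := (exteriorPower.ιMulti ℂ 2 (M := M)).map_swap ![b, a] (i := 0) (j := 1) zero_ne_one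
  rw [← h]
  congr 1
  ext i
  fin_cases i <;> rfl

theorem wedge_two_add_right (M : Type*) [AddCommGroup M] [Module ℂ M] (a b c : M) :
    exteriorPower.ιMulti ℂ 2 ![c, a + b] =
      exteriorPower.ιMulti ℂ 2 ![c, a] + exteriorPower.ιMulti ℂ 2 ![c, b] := by
  rw [wedge_two_swap, wedge_two_add_left, neg_add, ← wedge_two_swap, ← wedge_two_swap]

theorem wedge_two_smul_right (M : Type*) [AddCommGroup M] [Module ℂ M] (s : ℂ) (a c : M) :
    exteriorPower.ιMulti ℂ 2 ![c, s • a] = s • exteriorPower.ιMulti ℂ 2 ![c, a] := by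
  rw [wedge_two_swap, wedge_two_smul_left, wedge_two_swap M c a, smul_neg]

/-- The map `V → ⋀² (ℂ ⊕ V)`, `u ↦ (1, 0) ∧ (0, u)`. -/
def oneWedge : V →ₗ[ℂ] ⋀[ℂ]^2 (ℂ × V) where
  toFun u := exteriorPower.ιMulti ℂ 2 ![((1 : ℂ), (0 : V)), (0, u)]
  map_add' u v := by
    rw [← wedge_two_add_right, Prod.mk_add_mk, add_zero]
  map_smul' c u := by
    rw [RingHom.id_apply, ← wedge_two_smul_right, Prod.smul_mk, smul_zero]

theorem oneWedge_apply (u : V) :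
    oneWedge V u = exteriorPower.ιMulti ℂ 2 ![((1 : ℂ), (0 : V)), (0, u)] := rfl

/-- The natural isomorphism `⋀² (ℂ ⊕ V) ≃ V ⊕ ⋀² V`, given by
`(s, u) ∧ (t, v) ↦ (s v - t u, u ∧ v)`. -/
def splitting : ⋀[ℂ]^2 (ℂ × V) ≃ₗ[ℂ] V × ⋀[ℂ]^2 V :=
  LinearEquiv.ofLinearMap
    ((splitFst V).prod (exteriorPower.map 2 (LinearMap.snd ℂ ℂ V)))
    ((oneWedge V).coprod (exteriorPower.map 2 (LinearMap.inr ℂ ℂ V)))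
    (by
      refine LinearMap.prod_ext (LinearMap.ext fun u => ?_)
        (exteriorPower.linearMap_ext (AlternatingMap.ext fun p => ?_))
      · have h : exteriorPower.map 2 (LinearMap.snd ℂ ℂ V) (oneWedge V u) = 0 := by
          rw [oneWedge_apply, exteriorPower.map_apply_ιMulti]
          exact (exteriorPower.ιMulti ℂ 2).map_coord_zero 0 rfl
        have h' : splitFst V (oneWedge V u) = u := by
          rw [oneWedge_apply, splitFst_ιMulti]
          simp
        simp [h, h']
      · have h : splitFst V (exteriorPower.map 2 (LinearMap.inr ℂ ℂ V)
            (exteriorPower.ιMulti ℂ 2 p)) = 0 := by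
          rw [exteriorPower.map_apply_ιMulti, splitFst_ιMulti]
          simp
        have h' : exteriorPower.map 2 (LinearMap.snd ℂ ℂ V) (exteriorPower.map 2
            (LinearMap.inr ℂ ℂ V) (exteriorPower.ιMulti ℂ 2 p)) =
              exteriorPower.ιMulti ℂ 2 p := by
          rw [exteriorPower.map_apply_ιMulti, exteriorPower.map_apply_ιMulti]
          rfl
        simp only [LinearMap.compAlternatingMap_apply, LinearMap.comp_apply,
          LinearMap.inr_apply, LinearMap.coprod_apply, map_zero, zero_add, LinearMap.prod_apply,
          Function.prod, h, h', LinearMap.id_apply])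
    (by
      refine exteriorPower.linearMap_ext (AlternatingMap.ext fun p => ?_)
      obtain ⟨s, u, hp0⟩ : ∃ s u, p 0 = (s, u) := ⟨_, _, rfl⟩
      obtain ⟨t, v, hp1⟩ : ∃ t v, p 1 = (t, v) := ⟨_, _, rfl⟩
      have hp : p = ![s • ((1 : ℂ), (0 : V)) + (0, u), t • ((1 : ℂ), (0 : V)) + (0, v)] := by
        ext i : 1
        fin_cases i <;> simp [hp0, hp1]
      have hm : exteriorPower.map 2 (LinearMap.inr ℂ ℂ V) (exteriorPower.map 2
          (LinearMap.snd ℂ ℂ V) (exteriorPower.ιMulti ℂ 2 p)) =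
            exteriorPower.ιMulti ℂ 2 ![((0 : ℂ), u), (0, v)] := by
        rw [exteriorPower.map_apply_ιMulti, exteriorPower.map_apply_ιMulti]
        congr 1
        ext i : 1
        fin_cases i <;> simp [hp0, hp1]
      have hs : splitFst V (exteriorPower.ιMulti ℂ 2 p) = s • v - t • u := by
        rw [splitFst_ιMulti, hp0, hp1]
      simp only [LinearMap.compAlternatingMap_apply, LinearMap.comp_apply,
        LinearMap.coprod_apply, LinearMap.prod_apply, Function.prod, LinearMap.id_apply, hm, hs,
        map_sub, map_smul, oneWedge_apply]
      rw [hp]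
      simp only [wedge_two_add_left, wedge_two_add_right, wedge_two_smul_left,
        wedge_two_smul_right, wedge_two_self, smul_zero, zero_add]
      rw [wedge_two_swap _ ((0 : ℂ), u) (1, 0), smul_neg]
      abel)

theorem splitting_ιMulti (p : Fin 2 → ℂ × V) :
    splitting V (exteriorPower.ιMulti ℂ 2 p) =
      ((p 0).1 • (p 1).2 - (p 1).1 • (p 0).2,
        exteriorPower.ιMulti ℂ 2 ![(p 0).2, (p 1).2]) := by
  refine Prod.ext (splitFst_ιMulti V p) ?_
  refine (exteriorPower.map_apply_ιMulti _ p).trans ?_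
  congr 1
  ext i : 1
  fin_cases i <;> rfl

end Splitting

/-! ### The Grassmannian `G(ℂ ⊕ G*, 2)` in `P(G* ⊕ ⋀² G*)` -/

section Grassmannian

variable (G : Type*) [AddCommGroup G] [Module ℂ G]

/-- The Grassmannian of two-dimensional quotients of `ℂ ⊕ G*`, embedded into `P(G* ⊕ ⋀² G*)` by the
Plücker embedding and the identification `⋀² (ℂ ⊕ G*) = G* ⊕ ⋀² G*`. -/
def grassmannian : Set (ℙ ℂ (Module.Dual ℂ (Forms 2 G))) :=
  Set.range fun N : Module.Grassmannian ℂ (ℂ × Module.Dual ℂ G) 2 =>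
    Projectivization.map (splitting (Module.Dual ℂ G)).symm.dualMap.toLinearMap
      (splitting (Module.Dual ℂ G)).symm.dualMap.injective (pluecker N)

/-- The Plücker ideal of `ℂ ⊕ G*`, transported to the coordinate ring of `P(G* ⊕ ⋀² G*)` by the
identification `⋀² (ℂ ⊕ G*) = G* ⊕ ⋀² G*`. -/
def grassmannianIdeal : Ideal (SymmetricAlgebra ℂ (Forms 2 G)) :=
  (plueckerIdeal (ℂ × Module.Dual ℂ G)).map
    (SymmetricAlgebra.lift (SymmetricAlgebra.ι ℂ (Forms 2 G) ∘ₗ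
      (splitting (Module.Dual ℂ G)).toLinearMap))

end Grassmannian

end Gensyz

end

open scoped LinearAlgebra.Projectivization

noncomputable section

namespace Gensyz


/-! ### Straightening products of Plücker coordinates -/

section Straightening

variable {n : ℕ}

/-! Write `Pf` for the ideal generated by the Pfaffians of `G*`. The algebraic core is `I = I_𝔾 ∩
(G*)`. Expanding a Pfaffian of `ℂ ⊕ G*` along the `ℂ`-coordinates gives `I ⊆ I_𝔾 ⊆ I + Pf`
(`grassmannianIdeal_le`), and `(G*) · Pf ⊆ I` (`linearIdeal_mul_pfaffianIdeal_le`). The retraction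
`killLeft` of `S` has kernel `(G*)` and fixes the generators of `Pf`, so `j - killLeft j ∈ I` for
every `j ∈ Pf`. If `i + j ∈ (G*)` with `i ∈ I` and `j ∈ Pf`, then `killLeft j = 0`, hence `j ∈ I`.

Radicality, saturation and the vanishing ideal rest on the second fundamental theorem for `2 × 2`
minors: the Plücker ideal is the kernel of the map to the minors of a generic `2 × n` matrix
(`genericHom_eq_zero_iff`). The Plücker relations rewrite every product of coordinates as a
combination of standard products, and the corresponding products of minors have distinct leading
monomials, hence are independent. So `I_𝔾` is prime, and over the infinite field `ℂ` it consists of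
the forms vanishing at all decomposable functionals `α ∧ β`; the nonzero ones are the points of the
cone over the Grassmannian. As `(G*)` is prime too, `I` is radical. A prime ideal missing some
linear form is saturated, which gives saturation.

On closed points, a functional killed by the quadrics either vanishes on `G*` or is explicitly
decomposable (`gensyz_subset`). -/

/-- A multiset of pairs is increasing if it consists of pairs `(i, j)` with `i < j`. -/
def IsIncreasing (s : Multiset (Fin n × Fin n)) : Prop :=
  ∀ x ∈ s, x.1 < x.2

/-- An increasing multiset of pairs is standard if no pair is nested in another one. -/
def IsStandard (s : Multiset (Fin n × Fin n)) : Prop :=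
  IsIncreasing s ∧ ∀ x ∈ s, ∀ y ∈ s, x.1 < y.1 → x.2 ≤ y.2

/-- The sum of the squared lengths of the pairs in a multiset. -/
def nestingWeight (s : Multiset (Fin n × Fin n)) : ℕ :=
  (s.map fun x => ((x.2 : ℕ) - x.1) ^ 2).sum

/-- The relation `hp` replaces a nested pair `(a, d) ⊃ (b, c)` by a crossing and a disjoint one.
Both replacements strictly lower `nestingWeight`, so the rewriting terminates, and it can only stop
at a standard product. -/
theorem prod_mem_span_isStandard {R A : Type*} [CommRing R] [CommRing A] [Algebra R A]
    (p : Fin n × Fin n → A)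
    (hp : ∀ a b c d : Fin n, a < b → b < c → c < d →
      p (a, d) * p (b, c) = p (a, c) * p (b, d) - p (a, b) * p (c, d))
    (s : Multiset (Fin n × Fin n)) (hs : IsIncreasing s) :
    (s.map p).prod ∈
      Submodule.span R (Set.range fun t : {t // IsStandard (n := n) t} => (t.1.map p).prod) := by
  induction hN : nestingWeight s using Nat.strong_induction_on generalizing s with
  | _ N ih =>
    by_cases hst : IsStandard s
    · exact Submodule.subset_span ⟨⟨s, hst⟩, rfl⟩
    · have : ∃ x ∈ s, ∃ y ∈ s, x.1 < y.1 ∧ y.2 < x.2 := by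
        by_contra! h
        exact hst ⟨hs, h⟩
      obtain ⟨⟨a, d⟩, hx, ⟨b, c⟩, hy, hab, hcd⟩ := this
      have hbc : b < c := hs _ hy
      simp only at hab hcd
      obtain ⟨t, rfl⟩ := Multiset.exists_cons_of_mem hx
      have hy' : (b, c) ∈ t := by
        rcases Multiset.mem_cons.1 hy with h | h
        · simp only [Prod.mk.injEq] at h
          exact absurd h.1 hab.ne'
        · exact h
      obtain ⟨u, rfl⟩ := Multiset.exists_cons_of_mem hy'
      have hu : ∀ x ∈ u, x.1 < x.2 := fun x hx => hs x (by simp [hx])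
      have key : ((((a, d) ::ₘ (b, c) ::ₘ u).map p).prod : A) =
          (((a, c) ::ₘ (b, d) ::ₘ u).map p).prod - (((a, b) ::ₘ (c, d) ::ₘ u).map p).prod := by
        simp only [Multiset.map_cons, Multiset.prod_cons, ← mul_assoc]
        rw [hp a b c d hab hbc hcd, sub_mul]
      have ha : (a : ℕ) < b := hab
      have hb : (b : ℕ) < c := hbc
      have hc : (c : ℕ) < d := hcd
      obtain ⟨x, hx⟩ := Nat.exists_eq_add_of_lt ha
      obtain ⟨y, hy⟩ := Nat.exists_eq_add_of_lt hb
      obtain ⟨z, hz⟩ := Nat.exists_eq_add_of_lt hc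
      have e1 : (d : ℕ) - a = x + y + z + 3 := by omega
      have e2 : (c : ℕ) - b = y + 1 := by omega
      have e3 : (c : ℕ) - a = x + y + 2 := by omega
      have e4 : (d : ℕ) - b = y + z + 2 := by omega
      have e5 : (b : ℕ) - a = x + 1 := by omega
      have e6 : (d : ℕ) - c = z + 1 := by omega
      rw [key]
      refine Submodule.sub_mem _ (ih _ ?_ _ ?_ rfl) (ih _ ?_ _ ?_ rfl)
      · rw [← hN]
        -- The total length is unchanged and the sum of squares drops by `2 (x + 1) (z + 1)`.
        simp only [nestingWeight, Multiset.map_cons, Multiset.sum_cons, e1, e2, e3, e4]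
        nlinarith
      · intro v hv
        simp only [Multiset.mem_cons] at hv
        rcases hv with rfl | rfl | hv
        exacts [hab.trans hbc, hbc.trans hcd, hu v hv]
      · rw [← hN]
        simp only [nestingWeight, Multiset.map_cons, Multiset.sum_cons, e1, e2, e5, e6]
        nlinarith
      · intro v hv
        simp only [Multiset.mem_cons] at hv
        rcases hv with rfl | rfl | hv
        exacts [hab, hcd, hu v hv]

theorem span_isStandard_eq_top {R A : Type*} [CommRing R] [CommRing A] [Algebra R A]
    (p : Fin n × Fin n → A)
    (hp : ∀ a b c d : Fin n, a < b → b < c → c < d →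
      p (a, d) * p (b, c) = p (a, c) * p (b, d) - p (a, b) * p (c, d))
    (hgen : Algebra.adjoin R (p '' {x | x.1 < x.2}) = ⊤) :
    Submodule.span R (Set.range fun t : {t // IsStandard (n := n) t} => (t.1.map p).prod) = ⊤ := by
  rw [eq_top_iff, ← Algebra.top_toSubmodule, ← hgen, Algebra.adjoin_eq_span, Submodule.span_le]
  intro x hx
  obtain ⟨l, hl, rfl⟩ := Submonoid.exists_multiset_of_mem_closure hx
  have : ∃ s : Multiset (Fin n × Fin n), IsIncreasing s ∧ s.map p = l := by
    clear hx
    induction l using Multiset.induction_on with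
    | empty => exact ⟨0, by simp [IsIncreasing], rfl⟩
    | cons y l ih =>
      obtain ⟨s, hs, rfl⟩ := ih fun z hz => hl z (by simp [hz])
      obtain ⟨x, hx, rfl⟩ := hl y (by simp)
      exact ⟨x ::ₘ s, by simpa [IsIncreasing] using ⟨hx, fun a b h => hs (a, b) h⟩, by simp⟩
  obtain ⟨s, hs, rfl⟩ := this
  exact prod_mem_span_isStandard p hp s hs

/-- Sort lexicographically: the first entries are then sorted, and the absence of nesting forces the
second entries to be sorted as well. -/
theorem IsStandard.exists_list {s : Multiset (Fin n × Fin n)} (hs : IsStandard s) :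
    ∃ l : List (Fin n × Fin n), (l : Multiset (Fin n × Fin n)) = s ∧
      (l.map Prod.fst).Pairwise (· ≤ ·) ∧ (l.map Prod.snd).Pairwise (· ≤ ·) := by
  let e : Multiset (Fin n ×ₗ Fin n) := s.map toLex
  have hmem : ∀ x ∈ (e.sort (· ≤ ·)).map ofLex, x ∈ s := by
    intro x hx
    obtain ⟨y, hy, rfl⟩ := List.mem_map.1 hx
    obtain ⟨z, hz, rfl⟩ := Multiset.mem_map.1 ((Multiset.mem_sort _).1 hy)
    exact hz
  have hl : ((e.sort (· ≤ ·)).map ofLex).Pairwise fun x y => toLex x ≤ toLex y := by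
    rw [List.pairwise_map]
    exact Multiset.pairwise_sort e (· ≤ ·)
  refine ⟨(e.sort (· ≤ ·)).map ofLex, ?_, ?_, ?_⟩
  · rw [← Multiset.map_coe, Multiset.sort_eq, Multiset.map_map]
    exact Multiset.map_id s
  · rw [List.pairwise_map]
    refine hl.imp fun h => ?_
    rcases Prod.Lex.toLex_le_toLex.1 h with h | h
    exacts [h.le, h.1.le]
  · rw [List.pairwise_map]
    refine List.Pairwise.imp_of_mem (fun {x y} hx hy h => ?_) hl
    rcases Prod.Lex.toLex_le_toLex.1 h with h | h
    exacts [hs.2 _ (hmem _ hx) _ (hmem _ hy) h, h.2]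

/-- A standard multiset is determined by its first and its second entries. -/
theorem IsStandard.ext {s t : Multiset (Fin n × Fin n)} (hs : IsStandard s) (ht : IsStandard t)
    (h1 : s.map Prod.fst = t.map Prod.fst) (h2 : s.map Prod.snd = t.map Prod.snd) : s = t := by
  obtain ⟨l, rfl, hl1, hl2⟩ := hs.exists_list
  obtain ⟨m, rfl, hm1, hm2⟩ := ht.exists_list
  simp only [Multiset.map_coe, Multiset.coe_eq_coe] at h1 h2
  -- A sorted list is determined by its multiset of entries, so both coordinate lists agree, and the
  -- pairs are recovered by zipping them.
  have e1 := h1.eq_of_pairwise (fun _ _ _ _ => le_antisymm) hl1 hm1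
  have e2 := h2.eq_of_pairwise (fun _ _ _ _ => le_antisymm) hl2 hm2
  rw [← List.zip_unzip l, ← List.zip_unzip m]
  simp only [List.unzip_fst, List.unzip_snd, e1, e2]

end Straightening

/-! ### Leading monomials of products of `2 × 2` minors -/

section LeadingMonomial

open MvPolynomial
open scoped MonomialOrder

/-- In a vanishing combination, the largest leading monomial among the terms with nonzero
coefficient occurs in one term only and cannot cancel. -/
theorem linearIndependent_of_degree_injective {σ ι R : Type*} [CommRing R] [IsDomain R]
    (m : MonomialOrder σ) (f : ι → MvPolynomial σ R) (h0 : ∀ i, f i ≠ 0)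
    (hinj : Function.Injective fun i => m.degree (f i)) : LinearIndependent R f := by
  classical
  rw [linearIndependent_iff']
  intro s c hc
  by_contra! hne
  obtain ⟨i, hi, hci⟩ := hne
  obtain ⟨j, hj, hmax⟩ := (s.filter fun i => c i ≠ 0).exists_max_image
    (fun i => m.toSyn (m.degree (f i))) ⟨i, by simp [hi, hci]⟩
  simp only [Finset.mem_filter] at hj hmax
  have h := congrArg (coeff (m.degree (f j))) hc
  rw [coeff_sum, Finset.sum_eq_single_of_mem j hj.1, coeff_smul, coeff_zero, smul_eq_zero] at h
  · exact h.elim hj.2 (m.coeff_degree_ne_zero_iff.2 (h0 j))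
  · intro k hk hkj
    by_cases hck : c k = 0
    · simp [hck]
    · rw [coeff_smul, m.coeff_eq_zero_of_lt, smul_zero]
      refine lt_of_le_of_ne (hmax k ⟨hk, hck⟩) fun h => hkj (hinj (m.toSyn.injective h))

variable (R : Type*) [CommRing R] [IsDomain R] {n : ℕ}

/-- The `2 × 2` minors of the generic `2 × n` matrix with rows `X (inl i)` and `X (inr i)`. -/
def genericMinor (x : Fin n × Fin n) : MvPolynomial (Fin n ⊕ₗ Fin n) R :=
  X (Sum.inlₗ x.1) * X (Sum.inrₗ x.2) - X (Sum.inlₗ x.2) * X (Sum.inrₗ x.1)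

/-- The exponent of the leading monomial of a `2 × 2` minor. -/
def minorExponent (x : Fin n × Fin n) : (Fin n ⊕ₗ Fin n) →₀ ℕ :=
  Finsupp.single (Sum.inlₗ x.1) 1 + Finsupp.single (Sum.inrₗ x.2) 1

/-- In the lexicographic order, the first-row variable of smaller index dominates, so for `i < j`
the diagonal term of the minor leads. -/
theorem degree_genericMinor {x : Fin n × Fin n} (hx : x.1 < x.2) :
    genericMinor R x ≠ 0 ∧ MonomialOrder.lex.degree (genericMinor R x) = minorExponent x := by
  have hdeg : ∀ i j : Fin n, MonomialOrder.lex.degree (X (Sum.inlₗ i) * X (Sum.inrₗ j) :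
      MvPolynomial (Fin n ⊕ₗ Fin n) R) = minorExponent (i, j) := by
    intro i j
    rw [MonomialOrder.degree_mul (X_ne_zero _) (X_ne_zero _), MonomialOrder.degree_X,
      MonomialOrder.degree_X]
    rfl
  have hlt : MonomialOrder.lex.toSyn (minorExponent (x.2, x.1)) <
      MonomialOrder.lex.toSyn (minorExponent x) := by
    rw [MonomialOrder.lex_lt_iff]
    refine ⟨Sum.inlₗ x.1, fun j hj => ?_, ?_⟩
    · have h1 : Sum.inlₗ x.1 ≠ j := hj.ne'
      have h2 : Sum.inlₗ x.2 ≠ j := (hj.trans (Sum.Lex.inl_lt_inl_iff.2 hx)).ne'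
      have h3 : ∀ k, Sum.inrₗ k ≠ j := fun k => (hj.trans (Sum.Lex.inl_lt_inr _ _)).ne'
      simp [minorExponent, h1, h2, h3]
    · have h2 : (Sum.inlₗ x.2 : Fin n ⊕ₗ Fin n) ≠ Sum.inlₗ x.1 :=
        (Sum.Lex.inl_lt_inl_iff.2 hx).ne'
      simp [minorExponent, h2]
  have hd : MonomialOrder.lex.degree (genericMinor R x) = minorExponent x := by
    rw [genericMinor, MonomialOrder.degree_sub_of_lt, hdeg]
    rw [hdeg, hdeg]
    exact hlt
  refine ⟨MonomialOrder.ne_zero_of_degree_ne_zero (m := MonomialOrder.lex) ?_, hd⟩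
  rw [hd]
  intro h
  simpa [minorExponent] using DFunLike.congr_fun h (Sum.inlₗ x.1)

theorem degree_prod_genericMinor {s : Multiset (Fin n × Fin n)} (hs : IsIncreasing s) :
    (s.map (genericMinor R)).prod ≠ 0 ∧
      MonomialOrder.lex.degree (s.map (genericMinor R)).prod = (s.map minorExponent).sum := by
  induction s using Multiset.induction_on with
  | empty => simp
  | cons x s ih =>
    obtain ⟨h0, hd⟩ := ih fun y hy => hs y (by simp [hy])
    obtain ⟨hx0, hxd⟩ := degree_genericMinor R (hs x (by simp))
    simp only [Multiset.map_cons, Multiset.prod_cons, Multiset.sum_cons]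
    exact ⟨mul_ne_zero hx0 h0, by rw [MonomialOrder.degree_mul hx0 h0, hxd, hd]⟩

/-- Together with its `inr` counterpart, this recovers the multisets of first and second entries
from the leading monomial; by `IsStandard.ext` they determine a standard multiset. -/
theorem sum_minorExponent_inl (s : Multiset (Fin n × Fin n)) (i : Fin n) :
    (s.map minorExponent).sum (Sum.inlₗ i) = (s.map Prod.fst).count i := by
  induction s using Multiset.induction_on with
  | empty => simp
  | cons x s ih =>
    simp [ih, minorExponent, Finsupp.single_apply, Multiset.count_cons, add_comm, eq_comm]

theorem sum_minorExponent_inr (s : Multiset (Fin n × Fin n)) (i : Fin n) :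
    (s.map minorExponent).sum (Sum.inrₗ i) = (s.map Prod.snd).count i := by
  induction s using Multiset.induction_on with
  | empty => simp
  | cons x s ih =>
    simp [ih, minorExponent, Finsupp.single_apply, Multiset.count_cons, add_comm, eq_comm]

theorem linearIndependent_prod_genericMinor :
    LinearIndependent R
      fun s : {s // IsStandard (n := n) s} => (s.1.map (genericMinor R)).prod := by
  refine linearIndependent_of_degree_injective MonomialOrder.lex _
    (fun s => (degree_prod_genericMinor R s.2.1).1) fun s t h => ?_
  simp only [(degree_prod_genericMinor R s.2.1).2, (degree_prod_genericMinor R t.2.1).2] at h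
  refine Subtype.ext (s.2.ext t.2 ?_ ?_)
  · ext i
    rw [← sum_minorExponent_inl, ← sum_minorExponent_inl, h]
  · ext i
    rw [← sum_minorExponent_inr, ← sum_minorExponent_inr, h]

/-- The Plücker relations generate all relations between the minors of the generic `2 × n`
matrix. -/
theorem injective_of_pluecker_relations {A : Type*} [CommRing A] [Algebra R A]
    (p : Fin n × Fin n → A)
    (hp : ∀ a b c d : Fin n, a < b → b < c → c < d →
      p (a, d) * p (b, c) = p (a, c) * p (b, d) - p (a, b) * p (c, d))
    (hgen : Algebra.adjoin R (p '' {x | x.1 < x.2}) = ⊤)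
    (D : A →ₐ[R] MvPolynomial (Fin n ⊕ₗ Fin n) R) (hD : ∀ x, D (p x) = genericMinor R x) :
    Function.Injective D := by
  rw [injective_iff_map_eq_zero]
  intro f hf
  -- `D` carries a spanning family to a linearly independent one, so every coefficient of an element
  -- of the kernel vanishes.
  have hmem : f ∈ Submodule.span R
      (Set.range fun t : {t // IsStandard (n := n) t} => (t.1.map p).prod) := by
    rw [span_isStandard_eq_top p hp hgen]
    trivial
  obtain ⟨c, rfl⟩ := Finsupp.mem_span_range_iff_exists_finsupp.1 hmem
  have hc : Finsupp.linearCombination R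
      (fun s : {s // IsStandard (n := n) s} => (s.1.map (genericMinor R)).prod) c = 0 := by
    rw [← hf, Finsupp.linearCombination_apply, Finsupp.sum, Finsupp.sum, map_sum]
    refine Finset.sum_congr rfl fun s _ => ?_
    rw [map_smul, map_multiset_prod, Multiset.map_map]
    simp only [Function.comp_def, hD]
  rw [linearIndependent_iff.1 (linearIndependent_prod_genericMinor R) c hc, Finsupp.sum_zero_index]

end LeadingMonomial


/-! ### The minors of a pair of linear maps -/

section Minor

variable {E : Type*} [AddCommGroup E] [Module ℂ E]

section Algebra

variable {R : Type*} [CommRing R] [Algebra ℂ R]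

/-- The map `⋀² E → R`, `u ∧ v ↦ α(u) β(v) - α(v) β(u)`. -/
def minor (α β : E →ₗ[ℂ] R) : ⋀[ℂ]^2 E →ₗ[ℂ] R :=
  exteriorPower.alternatingMapLinearEquiv
    { toFun := fun p => α (p 0) * β (p 1) - α (p 1) * β (p 0)
      map_update_add' := by
        intro _ p i x y
        fin_cases i <;> simp <;> ring
      map_update_smul' := by
        intro _ p i c x
        fin_cases i <;> simp [smul_sub]
      map_eq_zero_of_eq' := by
        intro p i j h hij
        have h01 : p 0 = p 1 := by
          fin_cases i <;> fin_cases j <;> simp_all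
        rw [h01, sub_self] }

theorem minor_ιMulti (α β : E →ₗ[ℂ] R) (p : Fin 2 → E) :
    minor α β (exteriorPower.ιMulti ℂ 2 p) = α (p 0) * β (p 1) - α (p 1) * β (p 0) :=
  exteriorPower.alternatingMapLinearEquiv_apply_ιMulti _ _

theorem eq_minor_iff {α β : E →ₗ[ℂ] R} {ω : ⋀[ℂ]^2 E →ₗ[ℂ] R} :
    ω = minor α β ↔
      ∀ u v, ω (exteriorPower.ιMulti ℂ 2 ![u, v]) = α u * β v - α v * β u := by
  constructor
  · rintro rfl u v
    exact minor_ιMulti α β _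
  · intro h
    refine exteriorPower.linearMap_ext (AlternatingMap.ext fun p => ?_)
    rw [LinearMap.compAlternatingMap_apply, LinearMap.compAlternatingMap_apply, minor_ιMulti, ← h]
    congr 2

theorem lift_minor_wedge (α β : E →ₗ[ℂ] R) (u v : E) :
    SymmetricAlgebra.lift (minor α β) (wedge u v) = α u * β v - α v * β u := by
  rw [wedge, SymmetricAlgebra.lift_ι_apply]
  exact minor_ιMulti α β _

theorem lift_minor_eq_zero (α β : E →ₗ[ℂ] R) {f : SymmetricAlgebra ℂ (⋀[ℂ]^2 E)}
    (hf : f ∈ plueckerIdeal E) : SymmetricAlgebra.lift (minor α β) f = 0 := by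
  suffices plueckerIdeal E ≤ RingHom.ker (SymmetricAlgebra.lift (minor α β)) from this hf
  rw [plueckerIdeal, Ideal.span_le]
  rintro _ ⟨a, b, c, d, rfl⟩
  simp only [SetLike.mem_coe, RingHom.mem_ker, map_add, map_sub, map_mul, lift_minor_wedge]
  ring

theorem lift_minor_comp {R' : Type*} [CommRing R'] [Algebra ℂ R'] (g : R →ₐ[ℂ] R')
    (α β : E →ₗ[ℂ] R) (f : SymmetricAlgebra ℂ (⋀[ℂ]^2 E)) :
    g (SymmetricAlgebra.lift (minor α β) f) =
      SymmetricAlgebra.lift (minor (g.toLinearMap ∘ₗ α) (g.toLinearMap ∘ₗ β)) f := by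
  have h : g.comp (SymmetricAlgebra.lift (minor α β)) =
      SymmetricAlgebra.lift (minor (g.toLinearMap ∘ₗ α) (g.toLinearMap ∘ₗ β)) := by
    refine SymmetricAlgebra.algHom_ext ?_
    rw [SymmetricAlgebra.lift_comp_ι, eq_minor_iff]
    intro u v
    change g (SymmetricAlgebra.lift (minor α β) (wedge u v)) = _
    simp [lift_minor_wedge]
  exact DFunLike.congr_fun h f

end Algebra

theorem wedge_self (a : E) : wedge a a = 0 := by
  rw [wedge, wedge_two_self, map_zero]

theorem wedge_swap (a b : E) : wedge a b = -wedge b a := by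
  rw [wedge, wedge_two_swap, map_neg, wedge]

/-- Supplies the generation hypothesis of `injective_of_pluecker_relations`, once pushed to the
quotient by the Plücker ideal. -/
theorem adjoin_wedge_basis {n : ℕ} (e : Module.Basis (Fin n) ℂ E) :
    Algebra.adjoin ℂ ((fun x : Fin n × Fin n => wedge (e x.1) (e x.2)) '' {x | x.1 < x.2}) = ⊤ := by
  set A := Algebra.adjoin ℂ
    ((fun x : Fin n × Fin n => wedge (e x.1) (e x.2)) '' {x | x.1 < x.2}) with hA
  have hlt : ∀ i j, i < j → wedge (e i) (e j) ∈ A := fun i j h =>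
    Algebra.subset_adjoin ⟨(i, j), h, rfl⟩
  have hij : ∀ i j, wedge (e i) (e j) ∈ A := by
    intro i j
    rcases lt_trichotomy i j with h | rfl | h
    · exact hlt i j h
    · rw [wedge_self]
      exact A.zero_mem
    · rw [wedge_swap]
      exact A.neg_mem (hlt j i h)
  have hι : ∀ z, SymmetricAlgebra.ι ℂ (⋀[ℂ]^2 E) z ∈ A := by
    intro z
    have hz : z ∈ Submodule.span ℂ (exteriorPower.ιMulti ℂ 2 ''
        {a : Fin 2 → E | Set.range a ⊆ Set.range e}) := by
      rw [exteriorPower.ιMulti_span_of_span ℂ 2 E e.span_eq]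
      trivial
    induction hz using Submodule.span_induction with
    | mem z hz =>
      obtain ⟨a, ha, rfl⟩ := hz
      obtain ⟨i, hi⟩ := ha ⟨0, rfl⟩
      obtain ⟨j, hj⟩ := ha ⟨1, rfl⟩
      convert hij i j using 1
      rw [wedge, hi, hj]
      congr 2
    | zero => rw [map_zero]; exact A.zero_mem
    | add x y _ _ hx hy => rw [map_add]; exact A.add_mem hx hy
    | smul c x _ hx => rw [map_smul]; exact A.smul_mem hx c
  rw [eq_top_iff]
  rintro f -
  induction f using SymmetricAlgebra.induction with
  | algebraMap r => exact A.algebraMap_mem r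
  | ι z => exact hι z
  | mul a b ha hb => exact A.mul_mem ha hb
  | add a b ha hb => exact A.add_mem ha hb

section Generic

open MvPolynomial

variable {n : ℕ} (e : Module.Basis (Fin n) ℂ E)

/-- The rows of the generic `2 × n` matrix as linear maps, in terms of a basis. -/
def genericRow (k : Fin n → Fin n ⊕ₗ Fin n) : E →ₗ[ℂ] MvPolynomial (Fin n ⊕ₗ Fin n) ℂ :=
  e.constr ℂ fun i => X (k i)

/-- The coordinate ring of `P(⋀² E)` maps to the polynomial ring by the minors of the generic
matrix. -/
def genericHom : SymmetricAlgebra ℂ (⋀[ℂ]^2 E) →ₐ[ℂ] MvPolynomial (Fin n ⊕ₗ Fin n) ℂ :=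
  SymmetricAlgebra.lift (minor (genericRow e Sum.inlₗ) (genericRow e Sum.inrₗ))

theorem genericHom_eq_zero_iff (f : SymmetricAlgebra ℂ (⋀[ℂ]^2 E)) :
    genericHom e f = 0 ↔ f ∈ plueckerIdeal E := by
  refine ⟨fun hf => ?_, fun hf => lift_minor_eq_zero _ _ hf⟩
  let D := Ideal.Quotient.liftₐ (plueckerIdeal E) (genericHom e)
    fun a ha => lift_minor_eq_zero _ _ ha
  let p : Fin n × Fin n → SymmetricAlgebra ℂ (⋀[ℂ]^2 E) ⧸ plueckerIdeal E :=
    fun x => Ideal.Quotient.mkₐ ℂ _ (wedge (e x.1) (e x.2))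
  have hinj : Function.Injective D := by
    refine injective_of_pluecker_relations ℂ p (fun a b c d _ _ _ => ?_) ?_ D fun x => ?_
    · have h : Ideal.Quotient.mkₐ ℂ (plueckerIdeal E) (wedge (e a) (e b) * wedge (e c) (e d) -
          wedge (e a) (e c) * wedge (e b) (e d) + wedge (e a) (e d) * wedge (e b) (e c)) = 0 :=
        Ideal.Quotient.eq_zero_iff_mem.2 (Ideal.subset_span ⟨_, _, _, _, rfl⟩)
      simp only [map_add, map_sub, map_mul] at h
      simp only [p]
      linear_combination h
    · have h := congrArg (Subalgebra.map (Ideal.Quotient.mkₐ ℂ (plueckerIdeal E)))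
        (adjoin_wedge_basis e)
      rw [AlgHom.map_adjoin, Set.image_image, Algebra.map_top,
        (AlgHom.range_eq_top _).2 (Ideal.Quotient.mkₐ_surjective ℂ _)] at h
      exact h
    · change genericHom e (wedge (e x.1) (e x.2)) = _
      rw [genericHom, lift_minor_wedge]
      simp [genericRow, genericMinor]
  have h : D (Ideal.Quotient.mk _ f) = 0 := hf
  exact Ideal.Quotient.eq_zero_iff_mem.1 (hinj (h.trans (map_zero D).symm))

/-- Every pair `α, β` is a specialization of the two generic rows, so evaluating at `α ∧ β` factors
through `genericHom`. -/
theorem lift_minor_eq_eval (α β : E →ₗ[ℂ] ℂ) (f : SymmetricAlgebra ℂ (⋀[ℂ]^2 E)) :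
    SymmetricAlgebra.lift (minor α β) f =
      aeval (fun i => Sum.elim (fun j => α (e j)) (fun j => β (e j)) (ofLex i))
        (genericHom e f) := by
  rw [genericHom, lift_minor_comp]
  congr 3
  all_goals
    refine e.ext fun i => ?_
    simp [genericRow]

end Generic

variable (E) in
/-- The second fundamental theorem: the Plücker ideal consists of the relations between the
`2 × 2` minors. -/
theorem mem_plueckerIdeal_iff [FiniteDimensional ℂ E] {f : SymmetricAlgebra ℂ (⋀[ℂ]^2 E)} :
    f ∈ plueckerIdeal E ↔ ∀ α β : E →ₗ[ℂ] ℂ, SymmetricAlgebra.lift (minor α β) f = 0 := by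
  refine ⟨fun hf α β => lift_minor_eq_zero α β hf, fun h => ?_⟩
  let e := Module.finBasis ℂ E
  rw [← genericHom_eq_zero_iff e]
  -- A polynomial over an infinite field is zero once all its values are; each evaluation point `x`
  -- is the pair of rows of a complex matrix, i.e. a pair `α, β`.
  refine MvPolynomial.funext fun x => ?_
  have h' := h (e.constr ℂ fun i => x (Sum.inlₗ i)) (e.constr ℂ fun i => x (Sum.inrₗ i))
  rw [lift_minor_eq_eval e] at h'
  have hx : (fun i => Sum.elim (fun j => e.constr ℂ (fun i => x (Sum.inlₗ i)) (e j))
      (fun j => e.constr ℂ (fun i => x (Sum.inrₗ i)) (e j)) (ofLex i)) = x := by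
    funext i
    rcases h : ofLex i with j | j
    · obtain rfl : i = Sum.inlₗ j := h
      simp
    · obtain rfl : i = Sum.inrₗ j := h
      simp
  rw [hx] at h'
  rw [map_zero, ← h', ← MvPolynomial.coe_aeval_eq_eval]
  rfl

variable (E) in
theorem isPrime_plueckerIdeal [FiniteDimensional ℂ E] : (plueckerIdeal E).IsPrime := by
  have h : plueckerIdeal E = RingHom.ker (genericHom (Module.finBasis ℂ E)) := by
    ext f
    rw [RingHom.mem_ker, genericHom_eq_zero_iff]
  rw [h]
  exact RingHom.ker_isPrime _

theorem exists_minor_of_mem_pluecker (N : Module.Grassmannian ℂ E 2)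
    {ω : Module.Dual ℂ (⋀[ℂ]^2 E)} (hω : ω ∈ (pluecker N).submodule) :
    ∃ α β : E →ₗ[ℂ] ℂ, ω = minor α β := by
  rw [pluecker, Projectivization.submodule_mk''] at hω
  obtain ⟨η, rfl⟩ := hω
  have h2 : Module.finrank ℂ (E ⧸ N.toSubmodule) = 2 := by
    have h := N.rankAtStalk_eq ⊥
    rw [Module.rankAtStalk_eq_finrank_of_free] at h
    simpa using h
  let q := Module.finBasisOfFinrankEq ℂ (E ⧸ N.toSubmodule) h2
  -- On a two-dimensional quotient, `η` is its value on `q 0 ∧ q 1` times the determinant of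
  -- coordinates; the scalar is absorbed into the first functional.
  refine ⟨η (exteriorPower.ιMulti ℂ 2 ![q 0, q 1]) • q.coord 0 ∘ₗ N.toSubmodule.mkQ,
    q.coord 1 ∘ₗ N.toSubmodule.mkQ, eq_minor_iff.2 fun u v => ?_⟩
  have hq : ∀ w : E ⧸ N.toSubmodule, w = q.coord 0 w • q 0 + q.coord 1 w • q 1 := by
    intro w
    conv_lhs => rw [← q.sum_repr w, Fin.sum_univ_two]
    rfl
  have hm : exteriorPower.map 2 N.toSubmodule.mkQ (exteriorPower.ιMulti ℂ 2 ![u, v]) =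
      exteriorPower.ιMulti ℂ 2 ![N.toSubmodule.mkQ u, N.toSubmodule.mkQ v] := by
    rw [exteriorPower.map_apply_ιMulti]
    congr 1
    ext i : 1
    fin_cases i <;> rfl
  change η (exteriorPower.map 2 N.toSubmodule.mkQ (exteriorPower.ιMulti ℂ 2 ![u, v])) = _
  rw [hm]
  conv_lhs => rw [hq (N.toSubmodule.mkQ u), hq (N.toSubmodule.mkQ v)]
  simp only [wedge_two_add_left, wedge_two_add_right, wedge_two_smul_left,
    wedge_two_smul_right, wedge_two_self, wedge_two_swap _ (q 1) (q 0), smul_zero, map_add,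
    map_smul, map_neg, smul_eq_mul, LinearMap.smul_apply, LinearMap.comp_apply, smul_neg, map_zero]
  ring

/-- If `α ∧ β ≠ 0`, then `(α, β) : E → ℂ²` is onto, and the quotient by its kernel is the required
two-dimensional one: `α ∧ β` descends to it. -/
theorem exists_pluecker_of_minor_ne_zero {α β : E →ₗ[ℂ] ℂ} (h : minor α β ≠ 0) :
    ∃ N : Module.Grassmannian ℂ E 2, minor α β ∈ (pluecker N).submodule := by
  have : ∃ u v, α u * β v - α v * β u ≠ 0 := by
    by_contra! hc
    exact h (eq_minor_iff.2 fun u v => by rw [hc u v, LinearMap.zero_apply]).symm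
  obtain ⟨u, v, huv⟩ := this
  have hsurj : Function.Surjective (α.prod β) := by
    rintro ⟨s, t⟩
    -- Cramer's rule for `α = s`, `β = t` on the span of `u` and `v`.
    refine ⟨((s * β v - t * α v) / (α u * β v - α v * β u)) • u +
      ((t * α u - s * β u) / (α u * β v - α v * β u)) • v, ?_⟩
    simp only [LinearMap.prod_apply, Function.prod, map_add, map_smul, smul_eq_mul, Prod.smul_mk,
      Prod.mk_add_mk, Prod.mk.injEq]
    constructor <;>
      rw [div_mul_eq_mul_div, div_mul_eq_mul_div, ← add_div, div_eq_iff huv] <;> ring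
  let K := LinearMap.ker (α.prod β)
  let equiv : (E ⧸ K) ≃ₗ[ℂ] ℂ × ℂ := (α.prod β).quotKerEquivOfSurjective hsurj
  have hfin : Module.Finite ℂ (E ⧸ K) := Module.Finite.equiv equiv.symm
  refine ⟨⟨K, hfin, inferInstance, fun p => ?_⟩, ?_⟩
  · rw [Module.rankAtStalk_eq_finrank_of_free, equiv.finrank_eq]
    simp
  · rw [pluecker, Projectivization.submodule_mk'']
    refine ⟨minor (LinearMap.fst ℂ ℂ ℂ ∘ₗ equiv.toLinearMap)
      (LinearMap.snd ℂ ℂ ℂ ∘ₗ equiv.toLinearMap), eq_minor_iff.2 fun x y => ?_⟩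
    change minor _ _ (exteriorPower.map 2 K.mkQ (exteriorPower.ιMulti ℂ 2 ![x, y])) = _
    rw [exteriorPower.map_apply_ιMulti, minor_ιMulti]
    rfl

end Minor


/-! ### The ideals of the Grassmannian and of the linear subspace -/

section Ideals

variable (G : Type*) [AddCommGroup G] [Module ℂ G]

/-- The linear form `b ∧ c` in the coordinate ring of `P(G* ⊕ ⋀² G*)`. -/
def formsWedge (b c : Module.Dual ℂ G) : SymmetricAlgebra ℂ (Forms 2 G) :=
  formsRight 2 G (exteriorPower.ιMulti ℂ 2 ![b, c])

theorem formsWedge_swap (b c : Module.Dual ℂ G) : formsWedge G b c = -formsWedge G c b := by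
  rw [formsWedge, wedge_two_swap, map_neg, formsWedge]

/-- The quadric `a · (b ∧ c) - b · (a ∧ c) + c · (a ∧ b)`. -/
def quadric (a b c : Module.Dual ℂ G) : SymmetricAlgebra ℂ (Forms 2 G) :=
  formsLeft 2 G a * formsWedge G b c - formsLeft 2 G b * formsWedge G a c +
    formsLeft 2 G c * formsWedge G a b

/-- The Pfaffian of four elements of `G*`. -/
def formsPfaffian (a b c d : Module.Dual ℂ G) : SymmetricAlgebra ℂ (Forms 2 G) :=
  formsWedge G a b * formsWedge G c d - formsWedge G a c * formsWedge G b d +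
    formsWedge G a d * formsWedge G b c

/-- The Plücker ideal of `G*`, extended to the coordinate ring of `P(G* ⊕ ⋀² G*)`. -/
def pfaffianIdeal : Ideal (SymmetricAlgebra ℂ (Forms 2 G)) :=
  Ideal.span {q | ∃ a b c d, q = formsPfaffian G a b c d}

theorem syzygyQuadric_eq_quadric (v : Fin 3 → Module.Dual ℂ G) :
    syzygyQuadric 2 G (exteriorPower.ιMulti ℂ 3 v) = quadric G (v 0) (v 1) (v 2) := by
  have h0 : (0 : Fin 3).removeNth v = ![v 1, v 2] := by
    ext i : 1; fin_cases i <;> rfl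
  have h1 : (1 : Fin 3).removeNth v = ![v 0, v 2] := by
    ext i : 1; fin_cases i <;> rfl
  have h2 : (2 : Fin 3).removeNth v = ![v 0, v 1] := by
    ext i : 1; fin_cases i <;> rfl
  rw [syzygyQuadric_ιMulti, Fin.sum_univ_three, h0, h1, h2]
  simp [quadric, formsWedge, sub_eq_add_neg]

theorem quadric_mem (a b c : Module.Dual ℂ G) : quadric G a b c ∈ gensyzIdeal 2 G :=
  Ideal.subset_span ⟨exteriorPower.ιMulti ℂ 3 ![a, b, c], syzygyQuadric_eq_quadric G _⟩

theorem gensyzIdeal_le {I : Ideal (SymmetricAlgebra ℂ (Forms 2 G))}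
    (h : ∀ a b c, quadric G a b c ∈ I) : gensyzIdeal 2 G ≤ I := by
  rw [gensyzIdeal, Ideal.span_le]
  rintro _ ⟨z, rfl⟩
  have hz : z ∈ Submodule.span ℂ (Set.range (exteriorPower.ιMulti ℂ 3)) := by
    rw [exteriorPower.ιMulti_span]
    trivial
  change z ∈ (I.restrictScalars ℂ).comap (syzygyQuadric 2 G)
  refine Submodule.span_le.2 ?_ hz
  rintro _ ⟨v, rfl⟩
  change syzygyQuadric 2 G (exteriorPower.ιMulti ℂ 3 v) ∈ I
  rw [syzygyQuadric_eq_quadric]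
  exact h _ _ _

theorem formsLeft_mem (a : Module.Dual ℂ G) : formsLeft 2 G a ∈ linearIdeal 2 G :=
  Ideal.subset_span ⟨a, rfl⟩

theorem gensyzIdeal_le_linearIdeal : gensyzIdeal 2 G ≤ linearIdeal 2 G :=
  gensyzIdeal_le G fun a b c => Ideal.add_mem _ (Ideal.sub_mem _
    (Ideal.mul_mem_right _ _ (formsLeft_mem G a)) (Ideal.mul_mem_right _ _ (formsLeft_mem G b)))
    (Ideal.mul_mem_right _ _ (formsLeft_mem G c))

/-- The endomorphism of the coordinate ring that kills the linear forms in `G*`. -/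
def killLeft : SymmetricAlgebra ℂ (Forms 2 G) →ₐ[ℂ] SymmetricAlgebra ℂ (Forms 2 G) :=
  SymmetricAlgebra.lift (formsRight 2 G ∘ₗ LinearMap.snd ℂ _ _)

theorem killLeft_formsLeft (a : Module.Dual ℂ G) : killLeft G (formsLeft 2 G a) = 0 := by
  simp [killLeft, formsLeft]

theorem killLeft_formsRight (z : ⋀[ℂ]^2 (Module.Dual ℂ G)) :
    killLeft G (formsRight 2 G z) = formsRight 2 G z := by
  simp [killLeft, formsRight]

/-- Modulo `(G*)`, `killLeft` is the identity, as is seen on linear forms. Hence `(G*)` is the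
kernel of an endomorphism of a domain, which makes it prime. -/
theorem sub_killLeft_mem (f : SymmetricAlgebra ℂ (Forms 2 G)) :
    f - killLeft G f ∈ linearIdeal 2 G := by
  have h : (Ideal.Quotient.mkₐ ℂ (linearIdeal 2 G)).comp (killLeft G) =
      Ideal.Quotient.mkₐ ℂ (linearIdeal 2 G) := by
    refine SymmetricAlgebra.algHom_ext (LinearMap.ext fun z => ?_)
    refine ((Ideal.Quotient.mk_eq_mk_iff_sub_mem _ _).2 ?_).symm
    have hz : SymmetricAlgebra.ι ℂ (Forms 2 G) z = formsLeft 2 G z.1 + formsRight 2 G z.2 := by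
      simp [formsLeft, formsRight, ← map_add]
    change SymmetricAlgebra.ι ℂ (Forms 2 G) z -
      killLeft G (SymmetricAlgebra.ι ℂ (Forms 2 G) z) ∈ _
    rw [hz, map_add, killLeft_formsLeft, killLeft_formsRight, zero_add, add_sub_cancel_right]
    exact formsLeft_mem G z.1
  exact (Ideal.Quotient.mk_eq_mk_iff_sub_mem _ _).1 (DFunLike.congr_fun h f).symm

theorem mem_linearIdeal_iff {f : SymmetricAlgebra ℂ (Forms 2 G)} :
    f ∈ linearIdeal 2 G ↔ killLeft G f = 0 := by
  constructor
  · intro hf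
    suffices linearIdeal 2 G ≤ RingHom.ker (killLeft G) from this hf
    rw [linearIdeal, Ideal.span_le]
    rintro _ ⟨a, rfl⟩
    exact killLeft_formsLeft G a
  · intro hf
    simpa [hf] using sub_killLeft_mem G f

theorem isPrime_linearIdeal : (linearIdeal 2 G).IsPrime := by
  have h : linearIdeal 2 G = RingHom.ker (killLeft G) := by
    ext f
    rw [RingHom.mem_ker, mem_linearIdeal_iff]
  rw [h]
  exact RingHom.ker_isPrime _

theorem killLeft_formsPfaffian (a b c d : Module.Dual ℂ G) :
    killLeft G (formsPfaffian G a b c d) = formsPfaffian G a b c d := by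
  simp [formsPfaffian, formsWedge, killLeft_formsRight]

/-- Linear forms in `G*` multiply the Pfaffians of `G*` into the generic syzygy ideal. -/
theorem formsLeft_mul_formsPfaffian_mem (a b c d e : Module.Dual ℂ G) :
    formsLeft 2 G a * formsPfaffian G b c d e ∈ gensyzIdeal 2 G := by
  -- Modulo `I`, the product `a · Pf(b, c, d, e)` is symmetric in `a, b`, while it is alternating in
  -- `b, c`. The two symmetries together force twice the product to be zero.
  have hswap : ∀ a b c d e, formsLeft 2 G a * formsPfaffian G b c d e -
      formsLeft 2 G b * formsPfaffian G a c d e ∈ gensyzIdeal 2 G := by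
    intro a b c d e
    have : formsLeft 2 G a * formsPfaffian G b c d e -
        formsLeft 2 G b * formsPfaffian G a c d e =
        formsWedge G d e * quadric G a b c - formsWedge G c e * quadric G a b d +
          formsWedge G c d * quadric G a b e - formsWedge G a b * quadric G c d e := by
      simp only [quadric, formsPfaffian]
      ring
    rw [this]
    exact Ideal.sub_mem _ (Ideal.add_mem _ (Ideal.sub_mem _
      (Ideal.mul_mem_left _ _ (quadric_mem G a b c)) (Ideal.mul_mem_left _ _ (quadric_mem G a b d)))
      (Ideal.mul_mem_left _ _ (quadric_mem G a b e))) (Ideal.mul_mem_left _ _ (quadric_mem G c d e))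
  have halt : ∀ b c, formsPfaffian G b c d e = -formsPfaffian G c b d e := by
    intro b c
    simp only [formsPfaffian, formsWedge_swap G b c]
    ring
  have h2 : (2 : ℂ) • (formsLeft 2 G a * formsPfaffian G b c d e) ∈ gensyzIdeal 2 G := by
    have h := Ideal.add_mem _ (Ideal.sub_mem _ (hswap a b c d e) (hswap b c a d e))
      (hswap c a b d e)
    rw [halt c a, halt b a, halt c b] at h
    rw [two_smul]
    convert h using 1
    ring
  have h := Submodule.smul_of_tower_mem (gensyzIdeal 2 G) (2⁻¹ : ℂ) h2
  rwa [smul_smul, inv_mul_cancel₀ two_ne_zero, one_smul] at h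

theorem linearIdeal_mul_pfaffianIdeal_le :
    linearIdeal 2 G * pfaffianIdeal G ≤ gensyzIdeal 2 G := by
  rw [linearIdeal, pfaffianIdeal, Ideal.span_mul_span', Ideal.span_le]
  rintro _ ⟨_, ⟨a, rfl⟩, _, ⟨b, c, d, e, rfl⟩, rfl⟩
  exact formsLeft_mul_formsPfaffian_mem G a b c d e

theorem sub_killLeft_mem_gensyzIdeal {f : SymmetricAlgebra ℂ (Forms 2 G)}
    (hf : f ∈ pfaffianIdeal G) : f - killLeft G f ∈ gensyzIdeal 2 G := by
  induction hf using Submodule.span_induction with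
  | mem x hx =>
    obtain ⟨a, b, c, d, rfl⟩ := hx
    rw [killLeft_formsPfaffian, sub_self]
    exact Ideal.zero_mem _
  | zero => simp
  | add x y _ _ hx hy =>
    rw [map_add, add_sub_add_comm]
    exact Ideal.add_mem _ hx hy
  | smul c x hx h =>
    -- The first summand is handled by induction; the second lies in `(G*) · Pf`.
    have : c • x - killLeft G (c • x) =
        killLeft G c * (x - killLeft G x) + (c - killLeft G c) * x := by
      rw [smul_eq_mul, map_mul]
      ring
    rw [this]
    exact Ideal.add_mem _ (Ideal.mul_mem_left _ _ h)
      (linearIdeal_mul_pfaffianIdeal_le G (Ideal.mul_mem_mul (sub_killLeft_mem G c) hx))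

/-- The isomorphism of coordinate rings induced by `⋀² (ℂ ⊕ G*) = G* ⊕ ⋀² G*`. -/
def splitHom : SymmetricAlgebra ℂ (⋀[ℂ]^2 (ℂ × Module.Dual ℂ G)) →ₐ[ℂ]
    SymmetricAlgebra ℂ (Forms 2 G) :=
  SymmetricAlgebra.lift (SymmetricAlgebra.ι ℂ (Forms 2 G) ∘ₗ
    (splitting (Module.Dual ℂ G)).toLinearMap)

/-- The inverse of `splitHom`. -/
def splitHomInv : SymmetricAlgebra ℂ (Forms 2 G) →ₐ[ℂ]
    SymmetricAlgebra ℂ (⋀[ℂ]^2 (ℂ × Module.Dual ℂ G)) :=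
  SymmetricAlgebra.lift (SymmetricAlgebra.ι ℂ _ ∘ₗ
    (splitting (Module.Dual ℂ G)).symm.toLinearMap)

theorem splitHom_splitHomInv (f : SymmetricAlgebra ℂ (Forms 2 G)) :
    splitHom G (splitHomInv G f) = f := by
  have h : (splitHom G).comp (splitHomInv G) = AlgHom.id ℂ _ := by
    refine SymmetricAlgebra.algHom_ext (LinearMap.ext fun z => ?_)
    simp [splitHom, splitHomInv]
  exact DFunLike.congr_fun h f

theorem splitHomInv_splitHom (f : SymmetricAlgebra ℂ (⋀[ℂ]^2 (ℂ × Module.Dual ℂ G))) :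
    splitHomInv G (splitHom G f) = f := by
  have h : (splitHomInv G).comp (splitHom G) = AlgHom.id ℂ _ := by
    refine SymmetricAlgebra.algHom_ext (LinearMap.ext fun z => ?_)
    simp [splitHom, splitHomInv]
  exact DFunLike.congr_fun h f

theorem grassmannianIdeal_eq_comap :
    grassmannianIdeal G = (plueckerIdeal (ℂ × Module.Dual ℂ G)).comap (splitHomInv G) := by
  refine le_antisymm (Ideal.map_le_iff_le_comap.2 fun f hf => ?_) fun f hf => ?_
  · change splitHomInv G (splitHom G f) ∈ plueckerIdeal _
    rwa [splitHomInv_splitHom]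
  · rw [← splitHom_splitHomInv G f]
    exact Ideal.mem_map_of_mem _ hf

theorem isPrime_grassmannianIdeal [FiniteDimensional ℂ G] : (grassmannianIdeal G).IsPrime := by
  rw [grassmannianIdeal_eq_comap]
  have := isPrime_plueckerIdeal (ℂ × Module.Dual ℂ G)
  exact Ideal.comap_isPrime _ _

theorem splitHom_wedge (x y : ℂ × Module.Dual ℂ G) :
    splitHom G (wedge x y) =
      x.1 • formsLeft 2 G y.2 - y.1 • formsLeft 2 G x.2 + formsWedge G x.2 y.2 := by
  rw [wedge, splitHom, SymmetricAlgebra.lift_ι_apply, LinearMap.comp_apply,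
    LinearEquiv.coe_coe, splitting_ιMulti, ← map_smul, ← map_smul, ← map_sub, formsLeft,
    formsWedge, formsRight, LinearMap.comp_apply, LinearMap.comp_apply, ← map_add]
  simp

theorem quadric_mem_grassmannianIdeal (a b c : Module.Dual ℂ G) :
    quadric G a b c ∈ grassmannianIdeal G := by
  -- The quadric is the Pfaffian having `(1, 0)` as one of its four vectors, because `(1, 0) ∧ (0,
  -- u)` corresponds to the linear form `u ∈ G*`.
  have h : splitHom G (wedge (1, 0) (0, a) * wedge (0, b) (0, c) -
      wedge (1, 0) (0, b) * wedge (0, a) (0, c) + wedge (1, 0) (0, c) * wedge (0, a) (0, b)) ∈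
        grassmannianIdeal G :=
    Ideal.mem_map_of_mem _ (Ideal.subset_span ⟨_, _, _, _, rfl⟩)
  have h0 : ∀ u, formsWedge G 0 u = 0 := fun u => by
    rw [formsWedge, (exteriorPower.ιMulti ℂ 2).map_coord_zero 0 rfl, map_zero]
  simpa [splitHom_wedge, h0, quadric] using h

theorem gensyzIdeal_le_grassmannianIdeal : gensyzIdeal 2 G ≤ grassmannianIdeal G :=
  gensyzIdeal_le G (quadric_mem_grassmannianIdeal G)

theorem grassmannianIdeal_le : grassmannianIdeal G ≤ gensyzIdeal 2 G ⊔ pfaffianIdeal G := by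
  rw [grassmannianIdeal, plueckerIdeal, Ideal.map_span, Ideal.span_le]
  rintro _ ⟨_, ⟨a, b, c, d, rfl⟩, rfl⟩
  change splitHom G _ ∈ _
  -- Expansion along the `ℂ`-coordinates; the terms quadratic in them cancel.
  have : splitHom G (wedge a b * wedge c d - wedge a c * wedge b d + wedge a d * wedge b c) =
      (a.1 • quadric G b.2 c.2 d.2 - b.1 • quadric G a.2 c.2 d.2 + c.1 • quadric G a.2 b.2 d.2 -
        d.1 • quadric G a.2 b.2 c.2) + formsPfaffian G a.2 b.2 c.2 d.2 := by
    simp only [map_add, map_sub, map_mul, splitHom_wedge, quadric, formsPfaffian,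
      Algebra.smul_def]
    ring
  rw [this]
  refine Submodule.add_mem_sup ?_ (Ideal.subset_span ⟨_, _, _, _, rfl⟩)
  have h : ∀ (s : ℂ) a b c, s • quadric G a b c ∈ gensyzIdeal 2 G := fun s a b c =>
    Submodule.smul_of_tower_mem _ s (quadric_mem G a b c)
  exact Ideal.sub_mem _ (Ideal.add_mem _ (Ideal.sub_mem _ (h _ _ _ _) (h _ _ _ _)) (h _ _ _ _))
    (h _ _ _ _)

theorem gensyzIdeal_eq_inf : gensyzIdeal 2 G = grassmannianIdeal G ⊓ linearIdeal 2 G := by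
  refine le_antisymm (le_inf (gensyzIdeal_le_grassmannianIdeal G) (gensyzIdeal_le_linearIdeal G)) ?_
  rintro f ⟨hf, hf'⟩
  obtain ⟨i, hi, j, hj, rfl⟩ := Submodule.mem_sup.1 (grassmannianIdeal_le G hf)
  have h := (mem_linearIdeal_iff G).1 hf'
  rw [map_add, (mem_linearIdeal_iff G).1 (gensyzIdeal_le_linearIdeal G hi), zero_add] at h
  have h' := sub_killLeft_mem_gensyzIdeal G hj
  rw [h, sub_zero] at h'
  exact Ideal.add_mem _ hi h'

theorem isRadical_gensyzIdeal [FiniteDimensional ℂ G] : (gensyzIdeal 2 G).IsRadical := by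
  rw [gensyzIdeal_eq_inf]
  exact (isPrime_grassmannianIdeal G).isRadical.inf (isPrime_linearIdeal G).isRadical

end Ideals

/-! ### Saturation -/

section Saturation

/-- Multiply by `zⁿ`: primality allows the linear form `z ∉ P` to be cancelled. -/
theorem mem_of_irrelevantIdeal_pow_mul_mem {W : Type*} [AddCommGroup W] [Module ℂ W]
    {P : Ideal (SymmetricAlgebra ℂ W)} (hP : P.IsPrime) {z : W}
    (hz : SymmetricAlgebra.ι ℂ W z ∉ P) {f : SymmetricAlgebra ℂ W} {n : ℕ}
    (hf : ∀ m ∈ irrelevantIdeal W ^ n, m * f ∈ P) : f ∈ P := by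
  have h : SymmetricAlgebra.ι ℂ W z ∈ irrelevantIdeal W := Ideal.subset_span ⟨z, rfl⟩
  exact (hP.mem_or_mem (hf _ (Ideal.pow_mem_pow h n))).resolve_left
    fun h => hz (hP.mem_of_pow_mem _ h)

variable (G : Type*) [AddCommGroup G] [Module ℂ G] [FiniteDimensional ℂ G]

theorem mem_grassmannianIdeal_iff {f : SymmetricAlgebra ℂ (Forms 2 G)} :
    f ∈ grassmannianIdeal G ↔ ∀ α β : (ℂ × Module.Dual ℂ G) →ₗ[ℂ] ℂ,
      SymmetricAlgebra.lift (minor α β ∘ₗ (splitting (Module.Dual ℂ G)).symm.toLinearMap) f = 0 := by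
  rw [grassmannianIdeal_eq_comap, Ideal.mem_comap, mem_plueckerIdeal_iff]
  refine forall₂_congr fun α β => ?_
  have h : (SymmetricAlgebra.lift (minor α β)).comp (splitHomInv G) = SymmetricAlgebra.lift
      (minor α β ∘ₗ (splitting (Module.Dual ℂ G)).symm.toLinearMap) := by
    refine SymmetricAlgebra.algHom_ext (LinearMap.ext fun z => ?_)
    simp [splitHomInv]
  rw [← h]
  rfl

theorem exists_minor_ne_zero [Nontrivial G] :
    ∃ α β : (ℂ × Module.Dual ℂ G) →ₗ[ℂ] ℂ, minor α β ≠ 0 := by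
  obtain ⟨x, hx⟩ := exists_ne (0 : G)
  obtain ⟨v, hv⟩ : ∃ v : Module.Dual ℂ G, v x ≠ 0 := by
    by_contra! h
    exact hx ((Module.forall_dual_apply_eq_zero_iff ℂ x).1 h)
  -- This minor takes the value `v x` on `(1, 0) ∧ (0, v)`.
  refine ⟨LinearMap.fst ℂ _ _, Module.Dual.eval ℂ G x ∘ₗ LinearMap.snd ℂ _ _, fun h => hv ?_⟩
  simpa using (eq_minor_iff.1 h.symm (1, 0) (0, v)).symm

theorem exists_notMem_grassmannianIdeal [Nontrivial G] :
    ∃ z, SymmetricAlgebra.ι ℂ (Forms 2 G) z ∉ grassmannianIdeal G := by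
  obtain ⟨α, β, h⟩ := exists_minor_ne_zero G
  by_contra! hz
  refine h (LinearMap.ext fun y => ?_)
  simpa using (mem_grassmannianIdeal_iff G).1 (hz (splitting (Module.Dual ℂ G) y)) α β

theorem isSaturated_gensyzIdeal [Nontrivial G] : IsSaturated (gensyzIdeal 2 G) := by
  intro f n hf
  obtain ⟨z, hz⟩ := exists_notMem_grassmannianIdeal G
  have h1 : f ∈ grassmannianIdeal G :=
    mem_of_irrelevantIdeal_pow_mul_mem (isPrime_grassmannianIdeal G) hz
      fun m hm => gensyzIdeal_le_grassmannianIdeal G (hf m hm)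
  -- If `⋀² G* = 0`, then `(G*)` is the irrelevant ideal and is not saturated; but then `Pf = 0` and
  -- `I_𝔾 ⊆ I` already.
  by_cases hw : ∀ y, formsRight 2 G y = 0
  · have hJ : pfaffianIdeal G = ⊥ := by
      rw [eq_bot_iff, pfaffianIdeal, Ideal.span_le]
      rintro _ ⟨a, b, c, d, rfl⟩
      simp [formsPfaffian, formsWedge, hw]
    simpa [hJ] using grassmannianIdeal_le G h1
  · push Not at hw
    obtain ⟨y, hy⟩ := hw
    have h2 : f ∈ linearIdeal 2 G := by
      refine mem_of_irrelevantIdeal_pow_mul_mem (isPrime_linearIdeal G) (z := (0, y)) ?_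
        fun m hm => gensyzIdeal_le_linearIdeal G (hf m hm)
      rw [mem_linearIdeal_iff]
      change killLeft G (formsRight 2 G y) ≠ 0
      rwa [killLeft_formsRight]
    rw [gensyzIdeal_eq_inf]
    exact ⟨h1, h2⟩

end Saturation

/-! ### The sets of closed points -/

section Points

variable (G : Type*) [AddCommGroup G] [Module ℂ G]

theorem mem_zeroLocus_mk {W : Type*} [AddCommGroup W] [Module ℂ W]
    {I : Ideal (SymmetricAlgebra ℂ W)} {φ : Module.Dual ℂ W} {hφ : φ ≠ 0}
    (h : Projectivization.mk ℂ φ hφ ∈ zeroLocus I) {f : SymmetricAlgebra ℂ W} (hf : f ∈ I) :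
    SymmetricAlgebra.lift φ f = 0 :=
  h f hf φ (Submodule.mem_span_singleton_self φ)

theorem exists_minor_of_mem_grassmannian {p : ℙ ℂ (Module.Dual ℂ (Forms 2 G))}
    (hp : p ∈ grassmannian G) {φ : Module.Dual ℂ (Forms 2 G)} (hφ : φ ∈ p.submodule) :
    ∃ α β : (ℂ × Module.Dual ℂ G) →ₗ[ℂ] ℂ,
      φ = minor α β ∘ₗ (splitting (Module.Dual ℂ G)).symm.toLinearMap := by
  obtain ⟨N, rfl⟩ := hp
  obtain ⟨ω, hω, hN⟩ : ∃ ω, ∃ hω : ω ≠ 0, pluecker N = Projectivization.mk ℂ ω hω :=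
    ⟨_, (pluecker N).rep_nonzero, (pluecker N).mk_rep.symm⟩
  simp only [hN, Projectivization.map_mk, Projectivization.submodule_mk] at hφ
  obtain ⟨c, rfl⟩ := Submodule.mem_span_singleton.1 hφ
  have hc : c • ω ∈ (pluecker N).submodule := by
    rw [hN, Projectivization.submodule_mk]
    exact Submodule.smul_mem _ c (Submodule.mem_span_singleton_self ω)
  obtain ⟨α, β, h⟩ := exists_minor_of_mem_pluecker N hc
  refine ⟨α, β, ?_⟩
  rw [← h]
  rfl

theorem mk_mem_grassmannian {φ : Module.Dual ℂ (Forms 2 G)} (hφ : φ ≠ 0)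
    {α β : (ℂ × Module.Dual ℂ G) →ₗ[ℂ] ℂ}
    (h : φ = minor α β ∘ₗ (splitting (Module.Dual ℂ G)).symm.toLinearMap) :
    Projectivization.mk ℂ φ hφ ∈ grassmannian G := by
  have hm : minor α β ≠ 0 := by
    rintro h0
    rw [h0, LinearMap.zero_comp] at h
    exact hφ h
  obtain ⟨N, hN⟩ := exists_pluecker_of_minor_ne_zero hm
  have hN' : pluecker N = Projectivization.mk ℂ _ hm := by
    refine Projectivization.submodule_injective ?_
    rw [Projectivization.submodule_mk]
    refine (Submodule.eq_of_le_of_finrank_eq ?_ ?_).symm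
    · rwa [Submodule.span_singleton_le_iff_mem]
    · rw [finrank_span_singleton hm, Projectivization.finrank_submodule]
  refine ⟨N, ?_⟩
  simp only [hN', Projectivization.map_mk]
  subst h
  rfl

theorem grassmannianIdeal_eq_vanishingIdeal [FiniteDimensional ℂ G] [Nontrivial G] :
    grassmannianIdeal G = vanishingIdeal (grassmannian G) := by
  ext f
  rw [mem_grassmannianIdeal_iff]
  constructor
  · intro h p hp φ hφ
    obtain ⟨α, β, rfl⟩ := exists_minor_of_mem_grassmannian G hp hφ
    exact h α β
  · intro h
    have hne : ∀ α β : (ℂ × Module.Dual ℂ G) →ₗ[ℂ] ℂ, minor α β ≠ 0 →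
        minor α β ∘ₗ (splitting (Module.Dual ℂ G)).symm.toLinearMap ≠ 0 := by
      intro α β hm h0
      refine hm (LinearMap.ext fun y => ?_)
      simpa using DFunLike.congr_fun h0 (splitting (Module.Dual ℂ G) y)
    intro α β
    by_cases hm : minor α β = 0
    -- The zero functional is the vertex of the cone and lies on the line of any point; the
    -- Grassmannian has a point because `G ≠ 0`.
    · obtain ⟨α', β', hm'⟩ := exists_minor_ne_zero G
      rw [hm, LinearMap.zero_comp]
      exact h _ (mk_mem_grassmannian G (hne _ _ hm') rfl) 0 (Submodule.zero_mem _)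
    · exact h _ (mk_mem_grassmannian G (hne _ _ hm) rfl) _ (Submodule.mem_span_singleton_self _)

theorem mk_mem_linearSubspace {φ : Module.Dual ℂ (Forms 2 G)} (hφ : φ ≠ 0)
    (h : ∀ a, φ (a, 0) = 0) : Projectivization.mk ℂ φ hφ ∈ linearSubspace 2 G := by
  have hφ' : φ = (LinearMap.snd ℂ (Module.Dual ℂ G) (⋀[ℂ]^2 (Module.Dual ℂ G))).dualMap
      (φ ∘ₗ LinearMap.inr ℂ _ _) := by
    refine LinearMap.ext fun z => ?_
    have hz : z = (z.1, 0) + (0, z.2) := by simp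
    rw [hz, map_add, h, zero_add]
    simp
  have h0 : φ ∘ₗ LinearMap.inr ℂ _ _ ≠ 0 := by
    intro h0
    rw [h0, map_zero] at hφ'
    exact hφ hφ'
  refine ⟨Projectivization.mk ℂ _ h0, ?_⟩
  rw [Projectivization.map_mk, Projectivization.mk_eq_mk_iff']
  exact ⟨1, by rw [one_smul]; exact hφ'⟩

theorem linearSubspace_subset_gensyz : linearSubspace 2 G ⊆ gensyz 2 G := by
  rintro _ ⟨q, rfl⟩ f hf φ hφ
  induction q using Projectivization.ind with
  | h ω hω =>
    rw [Projectivization.map_mk, Projectivization.submodule_mk] at hφ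
    obtain ⟨c, rfl⟩ := Submodule.mem_span_singleton.1 hφ
    suffices linearIdeal 2 G ≤ RingHom.ker (SymmetricAlgebra.lift (c •
        (LinearMap.snd ℂ (Module.Dual ℂ G) (⋀[ℂ]^2 (Module.Dual ℂ G))).dualMap ω)) from
      this (gensyzIdeal_le_linearIdeal G hf)
    rw [linearIdeal, Ideal.span_le]
    rintro _ ⟨a, rfl⟩
    simp [formsLeft]

theorem grassmannian_subset_gensyz [FiniteDimensional ℂ G] : grassmannian G ⊆ gensyz 2 G := by
  intro p hp f hf φ hφ
  obtain ⟨α, β, rfl⟩ := exists_minor_of_mem_grassmannian G hp hφ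
  exact (mem_grassmannianIdeal_iff G).1 (gensyzIdeal_le_grassmannianIdeal G hf) α β

/-- Let `φ = (φ₁, φ₂)`. If `φ₁ ≠ 0`, normalize `a` so that `φ₁ a = 1`. The quadric in `a, b, c` then
gives `φ₂ = φ₁ ∧ β` with `β u = φ₂ (a ∧ u)`. -/
theorem gensyz_subset : gensyz 2 G ⊆ grassmannian G ∪ linearSubspace 2 G := by
  intro p hp
  induction p using Projectivization.ind with
  | h φ hφ =>
    by_cases h : ∀ a, φ (a, 0) = 0
    · exact Or.inr (mk_mem_linearSubspace G hφ h)
    · left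
      have hne : ∃ a, φ (a, 0) = 1 := by
        push Not at h
        obtain ⟨a, ha⟩ := h
        refine ⟨(φ (a, 0))⁻¹ • a, ?_⟩
        rw [← inv_mul_cancel₀ ha, ← smul_eq_mul, ← map_smul, Prod.smul_mk, smul_zero]
      obtain ⟨a, ha⟩ := hne
      let φ₁ : Module.Dual ℂ G →ₗ[ℂ] ℂ := φ ∘ₗ LinearMap.inl ℂ _ _
      let φ₂ : ⋀[ℂ]^2 (Module.Dual ℂ G) →ₗ[ℂ] ℂ := φ ∘ₗ LinearMap.inr ℂ _ _
      let β : Module.Dual ℂ G →ₗ[ℂ] ℂ :=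
        { toFun := fun u => φ₂ (exteriorPower.ιMulti ℂ 2 ![a, u])
          map_add' := fun u v => by rw [wedge_two_add_right, map_add]
          map_smul' := fun c u => by rw [wedge_two_smul_right, map_smul, RingHom.id_apply] }
      have hquad : ∀ b c, φ₂ (exteriorPower.ιMulti ℂ 2 ![b, c]) = φ₁ b * β c - φ₁ c * β b := by
        intro b c
        have hq := mem_zeroLocus_mk hp (quadric_mem G a b c)
        have ha' : φ₁ a = 1 := ha
        simp only [quadric, formsWedge, formsLeft, formsRight, map_add, map_sub, map_mul,
          LinearMap.comp_apply, SymmetricAlgebra.lift_ι_apply] at hq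
        change φ₁ a * φ₂ _ - φ₁ b * β c + φ₁ c * β b = 0 at hq
        rw [ha'] at hq
        linear_combination hq
      -- On `(s, u) ∧ (t, v)` the value of `φ` is `s φ₁(v) - t φ₁(u) + φ₁(u) β(v) - φ₁(v) β(u)`,
      -- which factors as `(s - β(u)) φ₁(v) - (t - β(v)) φ₁(u)`.
      refine mk_mem_grassmannian G hφ
        (α := LinearMap.fst ℂ ℂ _ - β ∘ₗ LinearMap.snd ℂ ℂ _)
        (β := φ₁ ∘ₗ LinearMap.snd ℂ ℂ _) ?_
      have hm : φ ∘ₗ (splitting (Module.Dual ℂ G)).toLinearMap =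
          minor (LinearMap.fst ℂ ℂ _ - β ∘ₗ LinearMap.snd ℂ ℂ _)
            (φ₁ ∘ₗ LinearMap.snd ℂ ℂ _) := by
        rw [eq_minor_iff]
        intro x y
        have hz : ∀ z : Forms 2 G, φ z = φ₁ z.1 + φ₂ z.2 := by
          intro z
          have hz : z = (z.1, 0) + (0, z.2) := by simp
          conv_lhs => rw [hz, map_add]
          rfl
        rw [LinearMap.comp_apply, LinearEquiv.coe_coe, splitting_ιMulti, hz]
        simp only [Matrix.cons_val_zero, Matrix.cons_val_one, hquad, map_sub, map_smul,
          smul_eq_mul, LinearMap.sub_apply, LinearMap.comp_apply, LinearMap.fst_apply,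
          LinearMap.snd_apply]
        ring
      rw [← hm]
      refine LinearMap.ext fun z => ?_
      simp

end Points

end Gensyz

end

theorem theorem6p1 (G : Type*) [AddCommGroup G] [Module ℂ G] [FiniteDimensional ℂ G]
    (g : ℕ) (hg : 1 ≤ g) (hG : Module.finrank ℂ G = g) :
    Gensyz.gensyz 2 G = Gensyz.grassmannian G ∪ Gensyz.linearSubspace 2 G ∧
    Gensyz.gensyzIdeal 2 G = Gensyz.grassmannianIdeal G ⊓ Gensyz.linearIdeal 2 G ∧
    Gensyz.grassmannianIdeal G = Gensyz.vanishingIdeal (Gensyz.grassmannian G) ∧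
    (Gensyz.gensyzIdeal 2 G).IsRadical ∧
    Gensyz.IsSaturated (Gensyz.gensyzIdeal 2 G) := by
  have : Nontrivial G := Module.nontrivial_of_finrank_pos (R := ℂ) (by omega)
  exact ⟨(Gensyz.gensyz_subset G).antisymm (Set.union_subset
    (Gensyz.grassmannian_subset_gensyz G) (Gensyz.linearSubspace_subset_gensyz G)),
    Gensyz.gensyzIdeal_eq_inf G, Gensyz.grassmannianIdeal_eq_vanishingIdeal G,
    Gensyz.isRadical_gensyzIdeal G, Gensyz.isSaturated_gensyzIdeal G⟩
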